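/- Let $\mathcal F=\{\phi_j\}_{j=1}^m$ be a list of vectors in $\mathbb C^d$, let $T:\mathbb C^m\to\mathbb C^d$ be the operator with $Te_j=\phi_j$, and let $G=T^*T$ be its Grammian and $S^{\mathcal F}=TT^*$ its frame operator. (The list is a frame if there are $a,b>0$ with $a\|x\|^2\le\sum_j|\langle x,\phi_j\rangle|^2\le b\|x\|^2$ for all $x\in\mathbb C^d$.) Write $\mathrm d(A)$ for the main diagonal of a matrix $A$, and consider the map $$\Phi_G:\mathcal U(m)\to\Delta(G)=\Big\{x\in\mathbb R^m:\ \sum_{j=1}^m x_j=\operatorname{tr}G\Big\},\qquad \Phi_G(U)=\mathrm d(U^*GU).$$ We say that $\Phi_G$ has a local cross section around the identity if there are a relatively open neighbourhood $V$ of $\mathrm d(G)$ in $\Delta(G)$ and a $C^\infty$ map $s:V\to\mathcal U(m)$ with $s(\mathrm d(G))=I$ and $\Phi_G(s(x))=x$ for all $x\in V$. We say that $\mathcal F$ splits orthogonally if there is $J\subseteq\{1,\dots,m\}$ with $\emptyset\ne J\ne\{1,\dots,m\}$ and $\langle\phi_j,\phi_k\rangle=0$ for all $j\in J$, $k\notin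 J$. (a) If $\mathcal F$ does not split orthogonally, then $\Phi_G$ has a local cross section around the identity. (b) Assume that $\Phi_G$ has a local cross section around the identity. Let $(S_i)_{i\in\mathbb N}$ be a sequence of positive semidefinite $d\times d$ complex matrices with $\operatorname{tr}S_i=\operatorname{tr}S^{\mathcal F}$ and $\operatorname{rank}S_i\le m$ for all $i$ (the latter is automatic if $d\le m$), converging to $S^{\mathcal F}$. Then for every $\eta>0$ there is $i_1$ such that for every $i\ge i_1$ there is a list $\mathcal G=\{\psi_j\}_{j=1}^m$ in $\mathbb C^d$ with 1. $\|\psi_j\|=\|\phi_j\|$ for $1\le j\le m$, 2. $\|\psi_j-\phi_j\|\le\eta$ for $1\le j\le m$, 3. $S^{\mathcal G}=S_i$, and $\mathcal G$ is a frame if $S_i$ is positive definite. (c) Assume that $\mathcal F$ is a frame that does not split orthogonally. Let $(S_i)_{i\in\mathbb N}$ be a sequence of positive semidefinite $d\times d$ complex matrices with $\operatorname{tr}S_i=\operatorname{tr}S^{\mathcal F}$ for all $i$, converging to $S^{\mathcal F}$. Then for every $\eta>0$ there is $i_1$ such that for every $i\ge i_1$ there is a frame $\mathcal G=\{\psi_j\}_{j=1}^m$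 for $\mathbb C^d$ satisfying 1, 2 and 3. -/

import Mathlib

open scoped ContDiff ComplexOrder

namespace FramePerturbation

/-- The matrix of the synthesis operator `T : ℂ^m → ℂ^d`, `T e_j = φ_j`: its `j`-th column
is `φ_j`. -/
def synthesis {m d : ℕ} (φ : Fin m → EuclideanSpace ℂ (Fin d)) : Matrix (Fin d) (Fin m) ℂ :=
  Matrix.of fun a j => φ j a

/-- The Grammian `T* T`. -/
def grammian {m d : ℕ} (φ : Fin m → EuclideanSpace ℂ (Fin d)) : Matrix (Fin m) (Fin m) ℂ :=
  (synthesis φ).conjTranspose * synthesis φ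

/-- The frame operator `T T*`. -/
def frameOperator {m d : ℕ} (φ : Fin m → EuclideanSpace ℂ (Fin d)) : Matrix (Fin d) (Fin d) ℂ :=
  synthesis φ * (synthesis φ).conjTranspose

/-- `φ_1, …, φ_m` is a frame for `ℂ^d`. -/
def IsFrame {m d : ℕ} (φ : Fin m → EuclideanSpace ℂ (Fin d)) : Prop :=
  ∃ a b : ℝ, 0 < a ∧ 0 < b ∧ ∀ x : EuclideanSpace ℂ (Fin d),
    a * ‖x‖ ^ 2 ≤ ∑ j, ‖inner ℂ x (φ j)‖ ^ 2 ∧ ∑ j, ‖inner ℂ x (φ j)‖ ^ 2 ≤ b * ‖x‖ ^ 2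

/-- The list can be partitioned into two (nonempty) sublists that are orthogonal to each other. -/
def OrthogonallySplits {m d : ℕ} (φ : Fin m → EuclideanSpace ℂ (Fin d)) : Prop :=
  ∃ J : Set (Fin m), J ≠ ∅ ∧ J ≠ Set.univ ∧ ∀ j ∈ J, ∀ k ∉ J, inner ℂ (φ j) (φ k) = 0

/-- The map `U ↦ d(U* G U)` on `U(m)`, where `d` is the main diagonal. It is used for Hermitian
`G`, for which the diagonal is real. -/
def diagMap {m : ℕ} (G : Matrix (Fin m) (Fin m) ℂ) (U : Matrix.unitaryGroup (Fin m) ℂ) :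
    Fin m → ℝ :=
  fun j => (((U : Matrix (Fin m) (Fin m) ℂ).conjTranspose * G * U) j j).re

/-- The affine hyperplane of real vectors whose coordinates add up to `tr G`; it is the codomain
of `diagMap G`. -/
def traceHyperplane {m : ℕ} (G : Matrix (Fin m) (Fin m) ℂ) : Set (Fin m → ℝ) :=
  {x | ∑ j, x j = G.trace.re}

/-- `diagMap G : U(m) → traceHyperplane G` has a (smooth) local cross section around the identity:
a smooth map `s` from a relatively open neighbourhood `V ∩ traceHyperplane G` of `d(G)` into `U(m)`
with `s (d(G)) = I` which is a right inverse of `diagMap G`. Values of `s` elsewhere play no role;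
smoothness into `U(m)` is smoothness of all matrix entries. -/
def HasLocalCrossSection {m : ℕ} (G : Matrix (Fin m) (Fin m) ℂ) : Prop :=
  ∃ (V : Set (Fin m → ℝ)) (s : (Fin m → ℝ) → Matrix.unitaryGroup (Fin m) ℂ),
    IsOpen V ∧ diagMap G 1 ∈ V ∧
    (∀ j k, ContDiffOn ℝ ∞ (fun x => (s x : Matrix (Fin m) (Fin m) ℂ) j k)
      (V ∩ traceHyperplane G)) ∧
    s (diagMap G 1) = 1 ∧
    ∀ x ∈ V ∩ traceHyperplane G, diagMap G (s x) = x

end FramePerturbation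

namespace FramePerturbation

open Matrix

variable {m d : ℕ}

/-! Move the diagonal of a Hermitian `G` by the unitaries `exp X`, with `X = [D, G]` and `D = diag
δ`. To first order the diagonal changes by that of `[G, X]`, whose pairing with `δ` is `tr X² =
-‖X‖²` (Frobenius norm). This vanishes only if `δ` is constant along the nonzero entries of `G`, so
for a connected graph only for constant `δ`. Adding `∑ δ` to every coordinate removes the constants,
and the inverse function theorem applies, with `G` itself replaced by a variable `H`
(`exists_joint_section`).

Freezing `H = G` gives (a). For (b), a section for `G` alone is not enough, since the Grammian has
to vary; but its existence forces `φ` not to split (`not_orthogonallySplits`), because splitting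
blocks have diagonal sums with zero derivative at `I`. So the joint section is available. Lift `S i`
to `R * Rᴴ = S i` with `R` near `T` (`eventually_exists_mul_conjTranspose`). The columns of `R U`,
with `U` the section at `(Rᴴ R, d(G))`, have the required norms, the same frame operator, and are
near those of `T`. In (c) a frame has `d ≤ m`, and positive definiteness persists near the limit. -/

/-- The graph on the indices given by the nonzero entries of `G` is connected: a real vector which
is constant along its edges is constant. -/
def IsConnectedMatrix (G : Matrix (Fin m) (Fin m) ℂ) : Prop :=
  ∀ δ : Fin m → ℝ, (∀ j k, G j k ≠ 0 → δ j = δ k) → ∀ j k, δ j = δ k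

/-! ### Commutators with diagonal matrices and their quadratic form. -/

/-- The commutator `[diag δ, G]`. -/
def diagCommutator (G : Matrix (Fin m) (Fin m) ℂ) :
    (Fin m → ℝ) →ₗ[ℝ] Matrix (Fin m) (Fin m) ℂ where
  toFun δ := Matrix.of fun j k => ((δ j - δ k : ℝ) : ℂ) * G j k
  map_add' x y := by
    ext j k
    simp only [Pi.add_apply, of_apply, Matrix.add_apply]
    push_cast
    ring
  map_smul' c x := by
    ext j k
    simp only [Pi.smul_apply, of_apply, Matrix.smul_apply, RingHom.id_apply, smul_eq_mul,
      Complex.real_smul]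
    push_cast
    ring

lemma diagCommutator_apply (G : Matrix (Fin m) (Fin m) ℂ) (δ : Fin m → ℝ) (j k : Fin m) :
    diagCommutator G δ j k = ((δ j - δ k : ℝ) : ℂ) * G j k := rfl

lemma conjTranspose_diagCommutator {G : Matrix (Fin m) (Fin m) ℂ} (hG : G.IsHermitian)
    (δ : Fin m → ℝ) : (diagCommutator G δ)ᴴ = -diagCommutator G δ := by
  ext j k
  rw [conjTranspose_apply, neg_apply, diagCommutator_apply, diagCommutator_apply, star_mul',
    hG.apply]
  simp only [Complex.star_def, Complex.conj_ofReal]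
  push_cast
  ring

/-- The real part of the main diagonal. -/
def reDiag : Matrix (Fin m) (Fin m) ℂ →ₗ[ℝ] (Fin m → ℝ) where
  toFun A j := (A j j).re
  map_add' A B := by ext; simp
  map_smul' c A := by ext; simp

lemma reDiag_apply (A : Matrix (Fin m) (Fin m) ℂ) (j : Fin m) : reDiag A j = (A j j).re := rfl

lemma sum_reDiag (A : Matrix (Fin m) (Fin m) ℂ) : ∑ j, reDiag A j = A.trace.re := by
  simp [reDiag_apply, trace, Complex.re_sum]

/-- By cyclicity of the trace the left side is `tr (D [G, X]) = tr X²` with `X = [D, G]`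
skew-Hermitian. In coordinates, this amounts to averaging the double sum with its transpose. -/
lemma sum_mul_reDiag_commutator {G : Matrix (Fin m) (Fin m) ℂ} (hG : G.IsHermitian)
    (δ : Fin m → ℝ) :
    ∑ j, δ j * reDiag (G * diagCommutator G δ - diagCommutator G δ * G) j =
      -∑ j, ∑ k, (δ j - δ k) ^ 2 * Complex.normSq (G j k) := by
  have hn (j k : Fin m) : G j k * G k j = (Complex.normSq (G j k) : ℂ) := by
    rw [← hG.apply k j, Complex.star_def, Complex.mul_conj]
  have hs (j k : Fin m) : Complex.normSq (G k j) = Complex.normSq (G j k) := by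
    rw [← hG.apply j k, Complex.star_def, Complex.normSq_conj]
  have h1 (j : Fin m) : reDiag (G * diagCommutator G δ - diagCommutator G δ * G) j =
      ∑ k, 2 * (δ k - δ j) * Complex.normSq (G j k) := by
    rw [reDiag_apply, Matrix.sub_apply, mul_apply, mul_apply, ← Finset.sum_sub_distrib,
      Complex.re_sum]
    refine Finset.sum_congr rfl fun k _ => ?_
    rw [diagCommutator_apply, diagCommutator_apply]
    have : G j k * (((δ k - δ j : ℝ) : ℂ) * G k j) - ((δ j - δ k : ℝ) : ℂ) * G j k * G k j =
        ((2 * (δ k - δ j) * Complex.normSq (G j k) : ℝ) : ℂ) := by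
      push_cast
      rw [← hn]
      ring
    rw [this, Complex.ofReal_re]
  simp_rw [h1, Finset.mul_sum]
  have h2 : ∑ j, ∑ k, δ j * (2 * (δ k - δ j) * Complex.normSq (G j k)) =
      ∑ j, ∑ k, δ k * (2 * (δ j - δ k) * Complex.normSq (G j k)) := by
    rw [Finset.sum_comm]
    simp_rw [fun j k => hs j k]
  have h3 : 2 * ∑ j, ∑ k, δ j * (2 * (δ k - δ j) * Complex.normSq (G j k)) =
      2 * -∑ j, ∑ k, (δ j - δ k) ^ 2 * Complex.normSq (G j k) := by
    rw [two_mul]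
    nth_rw 2 [h2]
    simp only [← Finset.sum_add_distrib, Finset.mul_sum, ← Finset.sum_neg_distrib]
    refine Finset.sum_congr rfl fun j _ => Finset.sum_congr rfl fun k _ => ?_
    ring
  linarith

/-- A commutator has trace zero, so summing the coordinates leaves `m ∑ δ = 0`. The quadratic form
then vanishes, `δ` is constant, and its sum is zero. -/
lemma eq_zero_of_reDiag_commutator {G : Matrix (Fin m) (Fin m) ℂ} (hG : G.IsHermitian)
    (hc : IsConnectedMatrix G) {δ : Fin m → ℝ}
    (h : (reDiag (G * diagCommutator G δ - diagCommutator G δ * G) + fun _ => ∑ k, δ k) = 0) :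
    δ = 0 := by
  ext j₀
  have hm : (m : ℝ) ≠ 0 := by
    have := j₀.pos
    positivity
  have hsum : ∑ k, δ k = 0 := by
    have := congrArg (fun x : Fin m → ℝ => ∑ j, x j) h
    simp only [Pi.add_apply, Finset.sum_add_distrib, sum_reDiag, trace_sub,
      trace_mul_comm G, sub_self] at this
    simpa [hm] using this
  have h0 : ∀ j, reDiag (G * diagCommutator G δ - diagCommutator G δ * G) j = 0 := fun j => by
    simpa [hsum] using congrFun h j
  have hq := sum_mul_reDiag_commutator hG δ
  simp only [h0, mul_zero, Finset.sum_const_zero] at hq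
  have hq' : ∑ j, ∑ k, (δ j - δ k) ^ 2 * Complex.normSq (G j k) = 0 := by linarith
  have hnn (j k : Fin m) : 0 ≤ (δ j - δ k) ^ 2 * Complex.normSq (G j k) :=
    mul_nonneg (sq_nonneg _) (Complex.normSq_nonneg _)
  have hz : ∀ j k, G j k ≠ 0 → δ j = δ k := by
    intro j k hjk
    rw [Finset.sum_eq_zero_iff_of_nonneg fun j _ => Finset.sum_nonneg fun k _ => hnn j k] at hq'
    have := hq' j (Finset.mem_univ _)
    rw [Finset.sum_eq_zero_iff_of_nonneg fun k _ => hnn j k] at this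
    have := this k (Finset.mem_univ _)
    simpa [hjk, sub_eq_zero] using this
  have := hc δ hz
  rw [Finset.sum_congr rfl fun k _ => this k j₀] at hsum
  simpa [hm] using hsum

/-! ### The inverse function theorem and the joint section. -/

section Smooth

open scoped Matrix.Norms.Operator

/-- The unitary matrix `exp [diag δ, G]`. -/
noncomputable def expUnitary {G : Matrix (Fin m) (Fin m) ℂ} (hG : G.IsHermitian) (δ : Fin m → ℝ) :
    unitaryGroup (Fin m) ℂ :=
  ⟨NormedSpace.exp (diagCommutator G δ), by
    rw [mem_unitaryGroup_iff', star_eq_conjTranspose, ← exp_conjTranspose,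
      conjTranspose_diagCommutator hG, exp_neg]
    exact nonsing_inv_mul _ ((isUnit_iff_isUnit_det _).mp (isUnit_exp _))⟩

lemma star_exp_diagCommutator {G : Matrix (Fin m) (Fin m) ℂ} (hG : G.IsHermitian)
    (δ : Fin m → ℝ) :
    (NormedSpace.exp (diagCommutator G δ))ᴴ = NormedSpace.exp (-diagCommutator G δ) := by
  rw [← exp_conjTranspose, conjTranspose_diagCommutator hG]

/-- `(H, δ) ↦ (H, d(U* H U) + (∑ δ) 1)` with `U = exp [diag δ, G]`. -/
noncomputable def perturbMap (G : Matrix (Fin m) (Fin m) ℂ)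
    (p : Matrix (Fin m) (Fin m) ℂ × (Fin m → ℝ)) : Matrix (Fin m) (Fin m) ℂ × (Fin m → ℝ) :=
  (p.1, reDiag (NormedSpace.exp (-diagCommutator G p.2) * p.1 *
    NormedSpace.exp (diagCommutator G p.2)) + fun _ => ∑ k, p.2 k)

lemma contDiff_exp_diagCommutator (G : Matrix (Fin m) (Fin m) ℂ) :
    ContDiff ℝ ω fun δ : Fin m → ℝ => NormedSpace.exp (diagCommutator G δ) := by
  have he : ContDiff ℝ ω (NormedSpace.exp : Matrix (Fin m) (Fin m) ℂ → _) :=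
    AnalyticOnNhd.contDiff fun x _ => NormedSpace.exp_analytic x
  exact he.comp (LinearMap.toContinuousLinearMap (diagCommutator G)).contDiff

lemma contDiff_perturbMap (G : Matrix (Fin m) (Fin m) ℂ) : ContDiff ℝ ω (perturbMap G) := by
  have h1 := (contDiff_exp_diagCommutator G).comp
    (contDiff_snd : ContDiff ℝ ω (Prod.snd : Matrix (Fin m) (Fin m) ℂ × (Fin m → ℝ) → _))
  have h2 := (contDiff_exp_diagCommutator G).comp
    (contDiff_snd.neg : ContDiff ℝ ω
      (fun p : Matrix (Fin m) (Fin m) ℂ × (Fin m → ℝ) => -p.2))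
  refine contDiff_fst.prodMk (ContDiff.add ?_ ?_)
  · refine (LinearMap.toContinuousLinearMap (reDiag (m := m))).contDiff.comp ?_
    refine ContDiff.mul (ContDiff.mul ?_ contDiff_fst) h1
    simpa [Function.comp_def] using h2
  · fun_prop

/-- The derivative of `perturbMap G` at `(G, 0)`. -/
noncomputable def perturbDeriv (G : Matrix (Fin m) (Fin m) ℂ) :
    Matrix (Fin m) (Fin m) ℂ × (Fin m → ℝ) →ₗ[ℝ] Matrix (Fin m) (Fin m) ℂ × (Fin m → ℝ) where
  toFun p := (p.1, reDiag (p.1 + (G * diagCommutator G p.2 - diagCommutator G p.2 * G)) +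
    fun _ => ∑ k, p.2 k)
  map_add' p q := by
    refine Prod.ext rfl ?_
    ext j
    simp [mul_add, add_mul, Finset.sum_add_distrib]
    ring
  map_smul' c p := by
    refine Prod.ext rfl ?_
    ext j
    simp [Finset.mul_sum]
    ring

lemma perturbDeriv_injective {G : Matrix (Fin m) (Fin m) ℂ} (hG : G.IsHermitian)
    (hc : IsConnectedMatrix G) : Function.Injective (perturbDeriv G) := by
  rw [← LinearMap.ker_eq_bot, LinearMap.ker_eq_bot']
  rintro ⟨H, δ⟩ h
  have h1 : H = 0 := congrArg Prod.fst h
  subst h1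
  have h2 := congrArg Prod.snd h
  simp only [perturbDeriv, LinearMap.coe_mk, AddHom.coe_mk, zero_add, Prod.snd_zero] at h2
  rw [eq_zero_of_reDiag_commutator hG hc h2]
  rfl

lemma hasFDerivAt_perturbMap (G : Matrix (Fin m) (Fin m) ℂ) :
    HasFDerivAt (perturbMap G) (LinearMap.toContinuousLinearMap (perturbDeriv G)) (G, 0) := by
  set p₀ : Matrix (Fin m) (Fin m) ℂ × (Fin m → ℝ) := (G, 0)
  set X : Matrix (Fin m) (Fin m) ℂ × (Fin m → ℝ) →L[ℝ] Matrix (Fin m) (Fin m) ℂ :=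
    (LinearMap.toContinuousLinearMap (diagCommutator G)).comp (ContinuousLinearMap.snd ℝ _ _)
  have hX0 : X p₀ = 0 := map_zero (diagCommutator G)
  have he : HasFDerivAt (NormedSpace.exp : Matrix (Fin m) (Fin m) ℂ → _)
      (1 : Matrix (Fin m) (Fin m) ℂ →L[ℝ] _) 0 := hasFDerivAt_exp_zero
  have h1 : HasFDerivAt (fun p => NormedSpace.exp (X p)) X p₀ := by
    have he' : HasFDerivAt (NormedSpace.exp : Matrix (Fin m) (Fin m) ℂ → _)
      (1 : Matrix (Fin m) (Fin m) ℂ →L[ℝ] _) (X p₀) := by rwa [hX0]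
    exact he'.comp p₀ X.hasFDerivAt
  have h2 : HasFDerivAt (fun p => NormedSpace.exp (-X p)) (-X) p₀ := by
    have he' : HasFDerivAt (NormedSpace.exp : Matrix (Fin m) (Fin m) ℂ → _)
      (1 : Matrix (Fin m) (Fin m) ℂ →L[ℝ] _) ((-X) p₀) := by
      rwa [_root_.neg_apply, hX0, neg_zero]
    exact he'.comp p₀ (-X).hasFDerivAt
  have h3 := (LinearMap.toContinuousLinearMap (reDiag (m := m))).hasFDerivAt.comp p₀
    ((h2.mul' hasFDerivAt_fst).mul' h1)
  have h4 : HasFDerivAt (fun p : Matrix (Fin m) (Fin m) ℂ × (Fin m → ℝ) =>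
      (fun _ => ∑ k, p.2 k : Fin m → ℝ))
      (ContinuousLinearMap.pi fun _ => ∑ k, (ContinuousLinearMap.proj k).comp
        (ContinuousLinearMap.snd ℝ _ _)) p₀ := by
    refine hasFDerivAt_pi.2 fun _ => ?_
    refine HasFDerivAt.fun_sum fun k _ => ?_
    exact ((ContinuousLinearMap.proj k).comp
        (ContinuousLinearMap.snd ℝ (Matrix (Fin m) (Fin m) ℂ) (Fin m → ℝ))).hasFDerivAt
  have h5 := hasFDerivAt_fst.prodMk (h3.add h4)
  refine HasFDerivAt.congr_fderiv h5 ?_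
  refine ContinuousLinearMap.ext fun q => Prod.ext rfl ?_
  have hL : (∑ k, (ContinuousLinearMap.proj k).comp
      (ContinuousLinearMap.snd ℝ (Matrix (Fin m) (Fin m) ℂ) (Fin m → ℝ))) q = ∑ k, q.2 k := by
    simp
  simp only [Pi.mul_apply, hX0, neg_zero, NormedSpace.exp_zero]
  change reDiag ((1 * G) * diagCommutator G q.2 + (1 * q.1 + -diagCommutator G q.2 * G) * 1) +
    (fun _ => (∑ k, (ContinuousLinearMap.proj k).comp
      (ContinuousLinearMap.snd ℝ (Matrix (Fin m) (Fin m) ℂ) (Fin m → ℝ))) q) =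
    reDiag (q.1 + (G * diagCommutator G q.2 - diagCommutator G q.2 * G)) + fun _ => ∑ k, q.2 k
  rw [hL]
  congr 2
  noncomm_ring

/-- If `G` is Hermitian with connected graph, then near `(G, d(G))` the diagonal of a matrix `H` can
be moved to any prescribed `y` of the right sum by a unitary depending smoothly on `(H, y)`. -/
theorem exists_joint_section {G : Matrix (Fin m) (Fin m) ℂ} (hG : G.IsHermitian)
    (hc : IsConnectedMatrix G) :
    ∃ σ : Matrix (Fin m) (Fin m) ℂ × (Fin m → ℝ) → unitaryGroup (Fin m) ℂ,
      σ (G, diagMap G 1) = 1 ∧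
      (∀ᶠ p in nhds (G, diagMap G 1), ContDiffAt ℝ ω
        (fun p => (σ p : Matrix (Fin m) (Fin m) ℂ)) p) ∧
      ∀ᶠ p in nhds (G, diagMap G 1), ∑ j, p.2 j = p.1.trace.re → diagMap p.1 (σ p) = p.2 := by
  set e : (Matrix (Fin m) (Fin m) ℂ × (Fin m → ℝ)) ≃L[ℝ] Matrix (Fin m) (Fin m) ℂ × (Fin m → ℝ) :=
    (LinearEquiv.ofInjectiveEndo _ (perturbDeriv_injective hG hc)).toContinuousLinearEquiv
  have he : HasFDerivAt (perturbMap G) (e : _ →L[ℝ] _) (G, 0) := hasFDerivAt_perturbMap G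
  have hcd : ContDiffAt ℝ ω (perturbMap G) (G, 0) := (contDiff_perturbMap G).contDiffAt
  have hω : (ω : WithTop ℕ∞) ≠ 0 := by simp
  have hval : perturbMap G (G, 0) = (G, diagMap G 1) := by
    refine Prod.ext rfl ?_
    ext j
    simp [perturbMap, diagMap, reDiag_apply, NormedSpace.exp_zero]
  set g := hcd.localInverse he hω
  have hg0 : g (G, diagMap G 1) = (G, 0) := by
    rw [← hval]
    exact hcd.localInverse_apply_image he hω
  have hgs : ContDiffAt ℝ ω g (G, diagMap G 1) := by
    rw [← hval]
    exact hcd.to_localInverse he hω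
  have hgr : ∀ᶠ p in nhds (G, diagMap G 1), perturbMap G (g p) = p := by
    rw [← hval]
    exact (hcd.hasStrictFDerivAt' he hω).eventually_right_inverse
  refine ⟨fun p => expUnitary hG (g p).2, ?_, ?_, ?_⟩
  · ext1
    simp [hg0, expUnitary, NormedSpace.exp_zero]
  · filter_upwards [hgs.eventually (by simp)] with p hp
    exact (contDiff_exp_diagCommutator G).contDiffAt.comp p (contDiffAt_snd.comp p hp)
  · filter_upwards [hgr] with p hp hsum
    have h1 : (g p).1 = p.1 := (Prod.ext_iff.mp hp).1
    have h2 : diagMap p.1 (expUnitary hG (g p).2) + (fun _ => ∑ k, (g p).2 k) = p.2 := by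
      have := congrArg Prod.snd hp
      simp only [perturbMap, h1, ← star_exp_diagCommutator hG] at this
      exact this
    have h3 : ∑ j, diagMap p.1 (expUnitary hG (g p).2) j = p.1.trace.re := by
      set U := expUnitary hG (g p).2
      have : ∑ j, diagMap p.1 U j = ((U : Matrix (Fin m) (Fin m) ℂ)ᴴ * p.1 * U).trace.re :=
        sum_reDiag _
      rw [this, trace_mul_comm, ← mul_assoc, ← star_eq_conjTranspose,
        Unitary.mul_star_self_of_mem U.2, one_mul]
    ext j
    -- Unitary conjugation preserves the trace, so on the hyperplane the sum of coordinates gives `m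
    -- ∑ δ = 0`: the correction term disappears.
    have h4 := congrArg (fun x : Fin m → ℝ => ∑ j, x j) h2
    simp only [Pi.add_apply, Finset.sum_add_distrib, h3, hsum] at h4
    have hm : (m : ℝ) ≠ 0 := by
      have := j.pos
      positivity
    have h5 : ∑ k, (g p).2 k = 0 := by simpa [hm] using h4
    simpa [h5] using congrFun h2 j

end Smooth

/-! ### Grammians and the local cross section of (a). -/

lemma grammian_apply (φ : Fin m → EuclideanSpace ℂ (Fin d)) (j k : Fin m) :
    grammian φ j k = inner ℂ (φ j) (φ k) := by
  simp [grammian, synthesis, mul_apply, PiLp.inner_apply, mul_comm]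

lemma isHermitian_grammian (φ : Fin m → EuclideanSpace ℂ (Fin d)) : (grammian φ).IsHermitian :=
  isHermitian_conjTranspose_mul_self _

lemma isConnectedMatrix_grammian {φ : Fin m → EuclideanSpace ℂ (Fin d)}
    (h : ¬ OrthogonallySplits φ) : IsConnectedMatrix (grammian φ) := by
  intro δ hδ j k
  by_contra hjk
  -- `G` has no nonzero entry between a level set of `δ` and its complement, so a nonconstant `δ`
  -- yields a splitting.
  refine h ⟨{i | δ i = δ j}, Set.Nonempty.ne_empty ⟨j, rfl⟩, fun hu => ?_, fun a ha b hb => ?_⟩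
  · exact hjk ((Set.eq_univ_iff_forall.mp hu k : δ k = δ j).symm)
  · by_contra hab
    rw [← grammian_apply] at hab
    exact hb ((hδ a b hab).symm.trans ha)

section

open scoped Matrix.Norms.Operator

lemma hasLocalCrossSection_of_isConnectedMatrix {G : Matrix (Fin m) (Fin m) ℂ}
    (hG : G.IsHermitian) (hc : IsConnectedMatrix G) : HasLocalCrossSection G := by
  obtain ⟨σ, h1, h2, h3⟩ := exists_joint_section hG hc
  have hcont : ContinuousAt (fun x : Fin m → ℝ => (G, x)) (diagMap G 1) := by fun_prop
  obtain ⟨V, hV, hVo, hmem⟩ := eventually_nhds_iff.mp ((hcont.eventually h2).and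
    (hcont.eventually h3))
  refine ⟨V, fun x => σ (G, x), hVo, hmem, fun j k => ?_, h1, fun x hx => (hV x hx.1).2 hx.2⟩
  intro x hx
  have := (LinearMap.toContinuousLinearMap (entryLinearMap ℝ ℂ j k)).contDiff.contDiffAt.comp x
    ((hV x hx.1).1.comp x (contDiffAt_const.prodMk contDiffAt_id))
  exact (this.of_le le_top).contDiffWithinAt

end

/-! ### A splitting obstructs local cross sections. -/

/-- The summand changes sign when `i` and `b` are exchanged. -/
lemma sum_re_mul_eq_zero_of_skew {G X : Matrix (Fin m) (Fin m) ℂ} (hG : G.IsHermitian)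
    (hX : Xᴴ = -X) (J : Finset (Fin m)) :
    ∑ i ∈ J, ∑ b ∈ J, (G i b * X b i).re = 0 := by
  have h (i b : Fin m) : (G b i * X i b).re = -(G i b * X b i).re := by
    have hx : X i b = -star (X b i) := by
      rw [← conjTranspose_apply, hX, neg_apply, neg_neg]
    rw [← hG.apply b i, hx]
    simp
  have h2 : ∑ i ∈ J, ∑ b ∈ J, (G i b * X b i).re = -∑ i ∈ J, ∑ b ∈ J, (G i b * X b i).re := by
    conv_lhs => rw [Finset.sum_comm]
    rw [← Finset.sum_neg_distrib]
    refine Finset.sum_congr rfl fun i _ => ?_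
    rw [← Finset.sum_neg_distrib]
    exact Finset.sum_congr rfl fun b _ => h i b
  linarith

/-- Along a differentiable curve of unitaries through `1`, the sum of the diagonal entries of
`U* G U` over a union of blocks of `G` has zero derivative. -/
lemma hasDerivAt_sum_diagMap {G : Matrix (Fin m) (Fin m) ℂ} (hG : G.IsHermitian)
    (J : Finset (Fin m)) (hJ : ∀ j ∈ J, ∀ k ∉ J, G j k = 0) (u : ℝ → unitaryGroup (Fin m) ℂ)
    (h0 : u 0 = 1)
    (hu : ∀ a b, DifferentiableAt ℝ (fun t => (u t : Matrix (Fin m) (Fin m) ℂ) a b) 0) :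
    HasDerivAt (fun t => ∑ j ∈ J, diagMap G (u t) j) 0 0 := by
  set X : Matrix (Fin m) (Fin m) ℂ :=
    Matrix.of fun a b => deriv (fun t => (u t : Matrix (Fin m) (Fin m) ℂ) a b) 0
  have hd (a b : Fin m) : HasDerivAt (fun t => (u t : Matrix (Fin m) (Fin m) ℂ) a b) (X a b) 0 :=
    (hu a b).hasDerivAt
  have hstar (a b : Fin m) : HasDerivAt (fun t => star ((u t : Matrix (Fin m) (Fin m) ℂ) a b))
      (star (X a b)) 0 := (hd a b).star
  -- Differentiate `U* U = 1` at `t = 0`, where `U = 1`.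
  have hskew : Xᴴ = -X := by
    ext i b
    have h1 : HasDerivAt (fun t => ∑ a, star ((u t : Matrix (Fin m) (Fin m) ℂ) a i) *
        (u t : Matrix (Fin m) (Fin m) ℂ) a b) (∑ a, (star (X a i) *
        (u 0 : Matrix (Fin m) (Fin m) ℂ) a b +
        star ((u 0 : Matrix (Fin m) (Fin m) ℂ) a i) * X a b)) 0 :=
      HasDerivAt.fun_sum fun a _ => (hstar a i).mul (hd a b)
    have h2 : (fun t => ∑ a, star ((u t : Matrix (Fin m) (Fin m) ℂ) a i) *
        (u t : Matrix (Fin m) (Fin m) ℂ) a b) =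
        fun _ => (1 : Matrix (Fin m) (Fin m) ℂ) i b := by
      ext t
      rw [← Unitary.star_mul_self_of_mem (u t).2]
      simp [mul_apply, star_apply]
    rw [h2] at h1
    have h3 := h1.unique (hasDerivAt_const _ _)
    simp only [h0, OneMemClass.coe_one, one_apply, Finset.sum_add_distrib, mul_ite, mul_one,
      mul_zero, Finset.sum_ite_eq', Finset.mem_univ, if_true] at h3
    simp [apply_ite, ite_mul] at h3
    rw [conjTranspose_apply, neg_apply]
    exact eq_neg_of_add_eq_zero_left h3
  have hdiag (j : Fin m) : HasDerivAt (fun t => diagMap G (u t) j)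
      (2 * ∑ b, (G j b * X b j).re) 0 := by
    have h1 : HasDerivAt (fun t => ∑ b, (∑ a, star ((u t : Matrix (Fin m) (Fin m) ℂ) a j) *
        G a b) * (u t : Matrix (Fin m) (Fin m) ℂ) b j)
        (∑ b, ((∑ a, star (X a j) * G a b) * (u 0 : Matrix (Fin m) (Fin m) ℂ) b j +
          (∑ a, star ((u 0 : Matrix (Fin m) (Fin m) ℂ) a j) * G a b) * X b j)) 0 :=
      HasDerivAt.fun_sum fun b _ =>
        (HasDerivAt.fun_sum fun a _ => (hstar a j).mul_const _).mul (hd b j)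
    have h2 := Complex.reCLM.hasFDerivAt.comp_hasDerivAt (0 : ℝ) h1
    have h3 : (fun t => diagMap G (u t) j) = Complex.reCLM ∘ fun t =>
        ∑ b, (∑ a, star ((u t : Matrix (Fin m) (Fin m) ℂ) a j) * G a b) *
          (u t : Matrix (Fin m) (Fin m) ℂ) b j := by
      ext t
      simp [diagMap, mul_apply]
    rw [h3]
    refine h2.congr_deriv ?_
    have h4 (a : Fin m) : star (X a j) * G a j = star (G j a * X a j) := by
      rw [star_mul, hG.apply a j]
    simp only [h0, OneMemClass.coe_one, one_apply, Finset.sum_add_distrib, mul_ite, mul_one,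
      mul_zero, Finset.sum_ite_eq', Finset.mem_univ, if_true, apply_ite star, star_one, star_zero,
      ite_mul, one_mul, zero_mul, h4, Complex.reCLM_apply, Complex.add_re, Complex.re_sum]
    simp only [Complex.star_def, Complex.conj_re]
    ring
  have h := HasDerivAt.fun_sum (u := J) fun j _ => hdiag j
  refine h.congr_deriv ?_
  -- The block structure cuts the inner sum down to `J`; what remains is a sum over `J × J`, which
  -- skewness kills.
  have h3 : ∀ j ∈ J, ∑ b, (G j b * X b j).re = ∑ b ∈ J, (G j b * X b j).re := by
    intro j hj
    refine (Finset.sum_subset (Finset.subset_univ J) fun b _ hb => ?_).symm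
    simp [hJ j hj b hb]
  rw [← Finset.mul_sum, Finset.sum_congr rfl h3, sum_re_mul_eq_zero_of_skew hG hskew, mul_zero]

/-- Follow the section along the line through `d(G)` in direction `e_j - e_k`, with `j ∈ J` and `k ∉
J`. The sum of the coordinates over `J` has slope 1 there, while `hasDerivAt_sum_diagMap` makes it
0. -/
lemma not_orthogonallySplits {φ : Fin m → EuclideanSpace ℂ (Fin d)}
    (h : HasLocalCrossSection (grammian φ)) : ¬ OrthogonallySplits φ := by
  classical
  rintro ⟨J, hJe, hJu, hJ⟩
  obtain ⟨j, hj⟩ := Set.nonempty_iff_ne_empty.mpr hJe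
  obtain ⟨k, hk⟩ := (Set.ne_univ_iff_exists_notMem J).mp hJu
  obtain ⟨V, s, hVo, hmem, hs, hs1, hsec⟩ := h
  set G := grammian φ
  set γ : ℝ → Fin m → ℝ := fun t => diagMap G 1 + t • (Pi.single j 1 - Pi.single k 1) with hγ
  have hγ0 : γ 0 = diagMap G 1 := by simp [hγ]
  have hγs : ContDiff ℝ ∞ γ := contDiff_const.add (contDiff_id.smul contDiff_const)
  have hγh (t : ℝ) : γ t ∈ traceHyperplane G := by
    have h1 : ∑ i, diagMap G 1 i = G.trace.re := by
      rw [← sum_reDiag]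
      simp [diagMap, reDiag_apply]
    simp [traceHyperplane, hγ, Finset.sum_add_distrib, h1, ← Finset.mul_sum]
  have hev : ∀ᶠ t in nhds (0 : ℝ), γ t ∈ V :=
    hγs.continuous.continuousAt.eventually (hVo.mem_nhds (by rwa [hγ0]))
  have hd := hasDerivAt_sum_diagMap (isHermitian_grammian φ) J.toFinset
    (fun a ha b hb => by
      rw [grammian_apply]
      exact hJ a (by simpa using ha) b (by simpa using hb)) (fun t => s (γ t))
    (by simp only [hγ0, hs1]) fun a b => by
      -- The line never leaves the hyperplane, so smoothness relative to the hyperplane becomes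
      -- ordinary smoothness in `t`.
      have h1 : ContDiffOn ℝ ∞ (fun t => (s (γ t) : Matrix (Fin m) (Fin m) ℂ) a b) (γ ⁻¹' V) :=
        (hs a b).comp hγs.contDiffOn fun t ht => ⟨ht, hγh t⟩
      exact (h1.contDiffAt hev).differentiableAt (by simp)
  have hlin : HasDerivAt (fun t => ∑ i ∈ J.toFinset, γ t i) 1 0 := by
    have : (fun t => ∑ i ∈ J.toFinset, γ t i) = fun t =>
        ∑ i ∈ J.toFinset, diagMap G 1 i + t := by
      ext t
      simp [hγ, Finset.sum_add_distrib, ← Finset.mul_sum, Pi.single_apply, hj, hk]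
    rw [this]
    exact (hasDerivAt_id 0).const_add _
  have heq : (fun t => ∑ i ∈ J.toFinset, diagMap G (s (γ t)) i) =ᶠ[nhds 0]
      fun t => ∑ i ∈ J.toFinset, γ t i := by
    filter_upwards [hev] with t ht
    rw [hsec _ ⟨ht, hγh t⟩]
  exact zero_ne_one (hd.unique (heq.hasDerivAt_iff.mpr hlin))

/-! ### Factorizations `R R*` and their lifts near `T`. -/

lemma exists_mul_conjTranspose_eq {S : Matrix (Fin d) (Fin d) ℂ} (hS : S.PosSemidef)
    (hr : S.rank ≤ m) : ∃ R : Matrix (Fin d) (Fin m) ℂ, R * Rᴴ = S := by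
  classical
  have hH := hS.isHermitian
  rw [hH.rank_eq_card_non_zero_eigs] at hr
  obtain ⟨e⟩ : Nonempty ({i // hH.eigenvalues i ≠ 0} ↪ Fin m) :=
    Function.Embedding.nonempty_of_card_le (by simpa using hr)
  set V : Matrix (Fin d) (Fin d) ℂ :=
    (hH.eigenvectorUnitary : unitaryGroup (Fin d) ℂ).1
  -- At most `m` eigenvalues are nonzero, so their square roots fit into distinct columns; rows of
  -- zero eigenvalues are zero.
  set P : Matrix (Fin d) (Fin m) ℂ := Matrix.of fun j k =>
    if h : hH.eigenvalues j ≠ 0 then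
      (if e ⟨j, h⟩ = k then ((Real.sqrt (hH.eigenvalues j) : ℝ) : ℂ) else 0) else 0 with hP
  have hPP : P * Pᴴ = diagonal (RCLike.ofReal ∘ hH.eigenvalues) := by
    ext i j
    rw [mul_apply, diagonal_apply]
    simp only [conjTranspose_apply, hP, of_apply]
    by_cases hi : hH.eigenvalues i = 0
    · simp [hi]
    by_cases hj : hH.eigenvalues j = 0
    · have hij : i ≠ j := by
        rintro rfl
        exact hi hj
      simp [hj, hij]
    by_cases hij : i = j
    · subst hij
      have := Real.mul_self_sqrt (hS.eigenvalues_nonneg i)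
      simp only [ne_eq, hi, not_false_eq_true, dite_true, if_true, ite_mul, zero_mul,
        Finset.sum_ite_eq, Finset.mem_univ, Function.comp_apply, Complex.star_def,
        Complex.conj_ofReal]
      rw [← Complex.ofReal_mul, this]
      rfl
    · simp [hi, hj, hij, Ne.symm hij]
  refine ⟨V * P, ?_⟩
  rw [conjTranspose_mul, Matrix.mul_assoc, ← Matrix.mul_assoc P, hPP]
  conv_rhs => rw [hH.spectral_theorem, Unitary.conjStarAlgAut_apply]
  rw [star_eq_conjTranspose, Matrix.mul_assoc]

lemma norm_toEuclideanLin_conjTranspose_sq (B : Matrix (Fin d) (Fin m) ℂ)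
    (x : EuclideanSpace ℂ (Fin d)) :
    ((‖toEuclideanLin Bᴴ x‖ ^ 2 : ℝ) : ℂ) = inner ℂ x (toEuclideanLin (B * Bᴴ) x) := by
  have h : toEuclideanLin (B * Bᴴ) x = toEuclideanLin B (toEuclideanLin Bᴴ x) := by
    simp [toLpLin_apply]
  rw [h, ← LinearMap.adjoint_inner_left, ← toEuclideanLin_conjTranspose_eq_adjoint,
    inner_self_eq_norm_sq_to_K]
  simp

/-- The hypothesis says `‖A* x‖ = ‖B* x‖` for all `x`, so `B* x ↦ A* x` is a well-defined isometry
on the range of `B*`. It extends to a unitary of `ℂ^m`, whose adjoint is the required `U`. -/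
lemma exists_unitary_mul_eq {A B : Matrix (Fin d) (Fin m) ℂ} (h : A * Aᴴ = B * Bᴴ) :
    ∃ U : unitaryGroup (Fin m) ℂ, B * (U : Matrix (Fin m) (Fin m) ℂ) = A := by
  set f := toEuclideanLin Bᴴ with hf
  set g := toEuclideanLin Aᴴ with hg
  have hn (x) : ‖g x‖ = ‖f x‖ := by
    have : ((‖g x‖ ^ 2 : ℝ) : ℂ) = ((‖f x‖ ^ 2 : ℝ) : ℂ) := by
      rw [hf, hg, norm_toEuclideanLin_conjTranspose_sq, norm_toEuclideanLin_conjTranspose_sq, h]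
    exact (sq_eq_sq₀ (norm_nonneg _) (norm_nonneg _)).mp (by exact_mod_cast this)
  have hker : LinearMap.ker f ≤ LinearMap.ker g := by
    intro x hx
    rw [LinearMap.mem_ker] at hx ⊢
    rw [← norm_eq_zero, hn, hx, norm_zero]
  set L₀ : LinearMap.range f →ₗ[ℂ] EuclideanSpace ℂ (Fin m) :=
    ((LinearMap.ker f).liftQ g hker).comp f.quotKerEquivRange.symm.toLinearMap with hL₀
  have hL (x) : L₀ ⟨f x, LinearMap.mem_range_self f x⟩ = g x := by
    have : f.quotKerEquivRange.symm ⟨f x, LinearMap.mem_range_self f x⟩ =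
        (LinearMap.ker f).mkQ x := f.quotKerEquivRange_symm_apply_image x _
    simp [hL₀, this]
  let L : LinearMap.range f →ₗᵢ[ℂ] EuclideanSpace ℂ (Fin m) :=
    { L₀ with
      norm_map' := by
        rintro ⟨_, x, rfl⟩
        change ‖L₀ _‖ = ‖f x‖
        rw [hL, hn] }
  set W := L.extend
  have hW (x) : W (f x) = g x :=
    (L.extend_apply ⟨f x, LinearMap.mem_range_self f x⟩).trans (hL x)
  set M : Matrix (Fin m) (Fin m) ℂ := toEuclideanLin.symm W.toLinearMap
  have hM : toEuclideanLin M = W.toLinearMap := LinearEquiv.apply_symm_apply _ _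
  have hMB : M * Bᴴ = Aᴴ := by
    apply toEuclideanLin.injective
    ext1 x
    have : toEuclideanLin (M * Bᴴ) x = toEuclideanLin M (f x) := by simp [hf, toLpLin_apply]
    rw [this, hM]
    exact hW x
  have hMM : Mᴴ * M = 1 := by
    apply toEuclideanLin.injective
    ext1 x
    have h1 : toEuclideanLin (Mᴴ * M) x = toEuclideanLin Mᴴ (toEuclideanLin M x) := by
      simp [toLpLin_apply]
    have h2 : toEuclideanLin (1 : Matrix (Fin m) (Fin m) ℂ) x = x := by simp
    rw [h1, h2, toEuclideanLin_conjTranspose_eq_adjoint, hM]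
    refine ext_inner_left ℂ fun y => ?_
    rw [LinearMap.adjoint_inner_right]
    exact W.inner_map_map y x
  refine ⟨star ⟨M, mem_unitaryGroup_iff'.mpr hMM⟩, ?_⟩
  rw [← conjTranspose_inj, ← hMB, conjTranspose_mul]
  simp [star_eq_conjTranspose]

lemma norm_apply_sq_le (R : Matrix (Fin d) (Fin m) ℂ) (a : Fin d) (k : Fin m) :
    ‖R a k‖ ^ 2 ≤ (R * Rᴴ).trace.re := by
  have h : (R * Rᴴ).trace.re = ∑ a, ∑ k, ‖R a k‖ ^ 2 := by
    simp [trace, mul_apply, Complex.mul_conj, Complex.re_sum, Complex.normSq_eq_norm_sq,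
      -Complex.ofReal_pow]
  rw [h]
  refine (Finset.single_le_sum (f := fun k => ‖R a k‖ ^ 2) (fun k _ => by positivity)
    (Finset.mem_univ k)).trans ?_
  exact Finset.single_le_sum (f := fun a => ∑ k, ‖R a k‖ ^ 2) (fun a _ => by positivity)
    (Finset.mem_univ a)

/-- The map `R ↦ R R*` from `d × m` matrices onto positive semidefinite matrices of rank at most
`m` and fixed trace is open, in sequential form. -/
lemma eventually_exists_mul_conjTranspose {T : Matrix (Fin d) (Fin m) ℂ}
    {S : ℕ → Matrix (Fin d) (Fin d) ℂ} (hS : ∀ i, (S i).PosSemidef)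
    (htr : ∀ i, (S i).trace = (T * Tᴴ).trace) (hr : ∀ i, (S i).rank ≤ m)
    (hlim : Filter.Tendsto S Filter.atTop (nhds (T * Tᴴ)))
    {p : Matrix (Fin d) (Fin m) ℂ → Prop} (hp : ∀ᶠ R in nhds T, p R) :
    ∀ᶠ i in Filter.atTop, ∃ R, p R ∧ R * Rᴴ = S i := by
  choose R hR using fun i => exists_mul_conjTranspose_eq (hS i) (hr i)
  -- If good lifts fail infinitely often, the fixed trace bounds the chosen factors `R` along the
  -- bad indices, and a subsequence converges to some `R'`.
  by_contra hcon
  obtain ⟨θ, hθ, hbad⟩ := Filter.extraction_of_frequently_atTop (Filter.not_eventually.mp hcon)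
  have hK : IsCompact (Set.pi Set.univ fun _ : Fin d => Set.pi Set.univ fun _ : Fin m =>
      Metric.closedBall (0 : ℂ) (Real.sqrt (T * Tᴴ).trace.re)) :=
    isCompact_univ_pi fun _ => isCompact_univ_pi fun _ => isCompact_closedBall _ _
  let R₀ (n : ℕ) : Fin d → Fin m → ℂ := R (θ n)
  obtain ⟨R', -, ρ, hρ, hRlim⟩ := hK.tendsto_subseq (x := R₀)
    fun n a _ k _ => by
      rw [mem_closedBall_zero_iff]
      refine Real.le_sqrt_of_sq_le ?_
      rw [← htr (θ n), ← hR]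
      exact norm_apply_sq_le _ _ _
  have hRlim' : Filter.Tendsto (fun n => R (θ (ρ n))) Filter.atTop
    (nhds (Matrix.of R' : Matrix (Fin d) (Fin m) ℂ)) := hRlim
  have hcont : Continuous fun A : Matrix (Fin d) (Fin m) ℂ => A * Aᴴ := by fun_prop
  have h1 := (hcont.tendsto _).comp hRlim'
  have h2 : Filter.Tendsto (fun n => S (θ (ρ n))) Filter.atTop (nhds (T * Tᴴ)) :=
    hlim.comp (hθ.tendsto_atTop.comp hρ.tendsto_atTop)
  have h3 : T * Tᴴ = Matrix.of R' * (Matrix.of R')ᴴ := by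
    refine tendsto_nhds_unique h2 ?_
    simpa only [Function.comp_def, hR] using h1
  -- `R'` and `T` factor the same matrix, so `R' U = T`; then the matrices `R U` are lifts
  -- converging to `T`, a contradiction.
  obtain ⟨U, hU⟩ := exists_unitary_mul_eq h3
  have hcont' : Continuous fun A : Matrix (Fin d) (Fin m) ℂ =>
    A * (U : Matrix (Fin m) (Fin m) ℂ) := by fun_prop
  have h4 := (hcont'.tendsto _).comp hRlim'
  rw [hU] at h4
  obtain ⟨n, hn⟩ := (h4.eventually hp).exists
  refine hbad (ρ n) ⟨_, hn, ?_⟩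
  change R (θ (ρ n)) * (U : Matrix (Fin m) (Fin m) ℂ) *
    (R (θ (ρ n)) * (U : Matrix (Fin m) (Fin m) ℂ))ᴴ = S (θ (ρ n))
  rw [conjTranspose_mul, Matrix.mul_assoc, ← Matrix.mul_assoc (U : Matrix (Fin m) (Fin m) ℂ),
    ← star_eq_conjTranspose (U : Matrix (Fin m) (Fin m) ℂ), Unitary.mul_star_self_of_mem U.2,
    Matrix.one_mul, hR]

/-! ### Restoring the column norms. -/

-- The other slice of the joint section: the target diagonal is frozen at `d(G)` and the matrix
-- varies.
open scoped Matrix.Norms.Operator in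
lemma exists_continuous_section {G : Matrix (Fin m) (Fin m) ℂ} (hG : G.IsHermitian)
    (hc : IsConnectedMatrix G) :
    ∃ σ : Matrix (Fin m) (Fin m) ℂ → unitaryGroup (Fin m) ℂ, σ G = 1 ∧
      ContinuousAt (fun H => (σ H : Matrix (Fin m) (Fin m) ℂ)) G ∧
      ∀ᶠ H in nhds G, H.trace.re = G.trace.re → diagMap H (σ H) = diagMap G 1 := by
  obtain ⟨σ, h1, h2, h3⟩ := exists_joint_section hG hc
  have hcont : ContinuousAt (fun H : Matrix (Fin m) (Fin m) ℂ => (H, diagMap G 1)) G := by fun_prop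
  refine ⟨fun H => σ (H, diagMap G 1), h1, ?_, ?_⟩
  · exact ContinuousAt.comp (f := fun H : Matrix (Fin m) (Fin m) ℂ => (H, diagMap G 1))
      h2.self_of_nhds.continuousAt hcont
  · filter_upwards [hcont.eventually h3] with H hH htr
    refine hH ?_
    rw [htr, ← sum_reDiag]
    simp [diagMap, reDiag_apply]

/-- Take the columns of `R σ(R* R)`. Their squared norms are the diagonal of the conjugated
Grammian, hence that of `G`; the unitary cancels in the frame operator; closeness is continuity
together with `σ G = 1`. -/
lemma eventually_exists_list {φ : Fin m → EuclideanSpace ℂ (Fin d)} (h : ¬ OrthogonallySplits φ)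
    {η : ℝ} (hη : 0 < η) :
    ∀ᶠ R in nhds (synthesis φ), (R * Rᴴ).trace = (frameOperator φ).trace →
      ∃ ψ : Fin m → EuclideanSpace ℂ (Fin d), (∀ j, ‖ψ j‖ = ‖φ j‖) ∧ (∀ j, ‖ψ j - φ j‖ ≤ η) ∧
        frameOperator ψ = R * Rᴴ := by
  obtain ⟨σ, h1, h2, h3⟩ := exists_continuous_section (isHermitian_grammian φ)
    (isConnectedMatrix_grammian h)
  have hgram : ContinuousAt (fun R : Matrix (Fin d) (Fin m) ℂ => Rᴴ * R) (synthesis φ) := by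
    fun_prop
  have hU : ContinuousAt (fun R : Matrix (Fin d) (Fin m) ℂ =>
      R * (σ (Rᴴ * R) : Matrix (Fin m) (Fin m) ℂ)) (synthesis φ) := by
    have hmul : Continuous fun p : Matrix (Fin d) (Fin m) ℂ × Matrix (Fin m) (Fin m) ℂ =>
        p.1 * p.2 := continuous_fst.matrix_mul continuous_snd
    have hσ : ContinuousAt (fun R : Matrix (Fin d) (Fin m) ℂ =>
        (σ (Rᴴ * R) : Matrix (Fin m) (Fin m) ℂ)) (synthesis φ) :=
      ContinuousAt.comp (g := fun H => (σ H : Matrix (Fin m) (Fin m) ℂ))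
        (f := fun R : Matrix (Fin d) (Fin m) ℂ => Rᴴ * R) h2 hgram
    exact hmul.continuousAt.comp (continuousAt_id.prodMk hσ)
  let ψ (R : Matrix (Fin d) (Fin m) ℂ) (j : Fin m) : EuclideanSpace ℂ (Fin d) :=
    WithLp.toLp 2 fun a => (R * (σ (Rᴴ * R) : Matrix (Fin m) (Fin m) ℂ)) a j
  have hψ0 (j) : ψ (synthesis φ) j = φ j := by
    ext a
    have : σ ((synthesis φ)ᴴ * synthesis φ) = 1 := h1
    simp only [ψ, this, OneMemClass.coe_one, Matrix.mul_one]
    rfl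
  have hψ (j) : ContinuousAt (fun R => ψ R j) (synthesis φ) := by
    refine (PiLp.continuous_toLp 2 _).continuousAt.comp (continuousAt_pi.mpr fun a => ?_)
    exact (continuous_id.matrix_elem a j).continuousAt.comp hU
  have hclose : ∀ᶠ R in nhds (synthesis φ), ∀ j, ‖ψ R j - φ j‖ ≤ η := by
    refine Filter.eventually_all.mpr fun j => ?_
    have := (hψ j).eventually (Metric.closedBall_mem_nhds _ hη)
    filter_upwards [this] with R hR
    rwa [hψ0, dist_eq_norm] at hR
  filter_upwards [hclose, hgram.eventually h3] with R hR hdiag htr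
  have hsyn : synthesis (ψ R) = R * (σ (Rᴴ * R) : Matrix (Fin m) (Fin m) ℂ) := rfl
  refine ⟨ψ R, fun j => ?_, hR, ?_⟩
  · have htr' : (Rᴴ * R).trace.re = (grammian φ).trace.re := by
      rw [trace_mul_comm, htr, frameOperator, grammian, trace_mul_comm]
    have h4 := congrFun (hdiag htr') j
    have h5 : diagMap (Rᴴ * R) (σ (Rᴴ * R)) j = (grammian (ψ R) j j).re := by
      rw [grammian, hsyn, conjTranspose_mul]
      simp only [diagMap, Matrix.mul_assoc]
    have h6 : diagMap (grammian φ) 1 j = (grammian φ j j).re := by simp [diagMap]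
    rw [h5, h6, grammian_apply, grammian_apply, inner_self_eq_norm_sq_to_K,
      inner_self_eq_norm_sq_to_K] at h4
    refine (sq_eq_sq₀ (norm_nonneg _) (norm_nonneg _)).mp ?_
    simpa [← Complex.ofReal_pow] using h4
  · rw [frameOperator, hsyn, conjTranspose_mul, Matrix.mul_assoc,
      ← Matrix.mul_assoc (σ (Rᴴ * R) : Matrix (Fin m) (Fin m) ℂ),
      ← star_eq_conjTranspose (σ (Rᴴ * R) : Matrix (Fin m) (Fin m) ℂ),
      Unitary.mul_star_self_of_mem (σ (Rᴴ * R)).2, Matrix.one_mul]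

/-! ### Frames and positive definite frame operators. -/

lemma posSemidef_frameOperator (φ : Fin m → EuclideanSpace ℂ (Fin d)) :
    (frameOperator φ).PosSemidef := posSemidef_self_mul_conjTranspose _

lemma sum_norm_inner_sq (φ : Fin m → EuclideanSpace ℂ (Fin d)) (x : EuclideanSpace ℂ (Fin d)) :
    ∑ j, ‖inner ℂ x (φ j)‖ ^ 2 = ‖toEuclideanLin (synthesis φ)ᴴ x‖ ^ 2 := by
  rw [EuclideanSpace.norm_sq_eq]
  refine Finset.sum_congr rfl fun j _ => ?_
  rw [← norm_inner_symm]
  congr 2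
  simp [toLpLin_apply, mulVec, dotProduct, synthesis, PiLp.inner_apply, mul_comm]

lemma isFrame_of_posDef {φ : Fin m → EuclideanSpace ℂ (Fin d)} (h : (frameOperator φ).PosDef) :
    IsFrame φ := by
  set f := toEuclideanLin (synthesis φ)ᴴ with hf
  have hker : LinearMap.ker f = ⊥ := by
    rw [LinearMap.ker_eq_bot']
    intro x hx
    have h1 := norm_toEuclideanLin_conjTranspose_sq (synthesis φ) x
    rw [← hf, hx] at h1
    by_contra hne
    have hne' : WithLp.ofLp x ≠ 0 := fun h0 => hne (by ext a; simpa using congrFun h0 a)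
    have h2 := h.dotProduct_mulVec_pos hne'
    have h3 : inner ℂ x (toEuclideanLin (synthesis φ * (synthesis φ)ᴴ) x) =
        star (WithLp.ofLp x) ⬝ᵥ (frameOperator φ *ᵥ WithLp.ofLp x) := by
      simp [toLpLin_apply, PiLp.inner_apply, dotProduct, frameOperator, mul_comm]
    rw [h3] at h1
    rw [← h1] at h2
    simp at h2
  obtain ⟨K, hK, hanti⟩ := f.exists_antilipschitzWith hker
  set F := LinearMap.toContinuousLinearMap f
  -- The lower bound comes from injectivity of `T*` in finite dimension; the `+ 1` keeps the upper
  -- constant positive even if `F = 0`.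
  refine ⟨((K : ℝ) ^ 2)⁻¹, ‖F‖ ^ 2 + 1, by positivity, by positivity, fun x => ?_⟩
  rw [sum_norm_inner_sq, ← hf]
  have h1 : ‖x‖ ≤ K * ‖f x‖ := by simpa using hanti.le_mul_dist x 0
  have h2 : ‖f x‖ ≤ ‖F‖ * ‖x‖ := F.le_opNorm x
  constructor
  · rw [inv_mul_le_iff₀ (by positivity), ← mul_pow]
    exact pow_le_pow_left₀ (norm_nonneg _) h1 2
  · have := pow_le_pow_left₀ (norm_nonneg _) h2 2
    nlinarith [sq_nonneg ‖x‖]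

lemma IsFrame.posDef_frameOperator {φ : Fin m → EuclideanSpace ℂ (Fin d)} (h : IsFrame φ) :
    (frameOperator φ).PosDef := by
  rw [(posSemidef_frameOperator φ).posDef_iff_det_ne_zero, ne_eq, ← exists_mulVec_eq_zero_iff]
  rintro ⟨v, hv, hv0⟩
  obtain ⟨a, b, ha, -, hab⟩ := h
  have h1 := (hab (WithLp.toLp 2 v)).1
  have h2 := norm_toEuclideanLin_conjTranspose_sq (synthesis φ) (WithLp.toLp 2 v)
  have h3 : toEuclideanLin (synthesis φ * (synthesis φ)ᴴ) (WithLp.toLp 2 v) = 0 := by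
    have : (synthesis φ * (synthesis φ)ᴴ) *ᵥ v = 0 := hv0
    simpa only [toLpLin_apply, this] using WithLp.toLp_zero 2
  rw [h3, inner_zero_right, Complex.ofReal_eq_zero] at h2
  rw [sum_norm_inner_sq, h2] at h1
  have h4 : WithLp.toLp 2 v = (0 : EuclideanSpace ℂ (Fin d)) := by
    by_contra hne
    have : 0 < ‖(WithLp.toLp 2 v : EuclideanSpace ℂ (Fin d))‖ := norm_pos_iff.mpr hne
    have : 0 < a * ‖(WithLp.toLp 2 v : EuclideanSpace ℂ (Fin d))‖ ^ 2 := by positivity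
    linarith
  exact hv (by simpa using h4)

/-- The synthesis matrix has rank `d` and only `m` columns. In (c) this makes the rank condition
automatic. -/
lemma IsFrame.le {φ : Fin m → EuclideanSpace ℂ (Fin d)} (h : IsFrame φ) : d ≤ m := by
  have h1 := rank_of_isUnit _ h.posDef_frameOperator.isUnit
  rw [frameOperator, rank_self_mul_conjTranspose, Fintype.card_fin] at h1
  have h2 := rank_le_width (synthesis φ)
  omega

/-! ### Assembly of the three statements. -/

theorem eventually_exists_perturbation {φ : Fin m → EuclideanSpace ℂ (Fin d)}
    (h : ¬ OrthogonallySplits φ) {S : ℕ → Matrix (Fin d) (Fin d) ℂ} (hS : ∀ i, (S i).PosSemidef)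
    (htr : ∀ i, (S i).trace = (frameOperator φ).trace) (hr : ∀ i, (S i).rank ≤ m)
    (hlim : Filter.Tendsto S Filter.atTop (nhds (frameOperator φ))) {η : ℝ} (hη : 0 < η) :
    ∀ᶠ i in Filter.atTop, ∃ ψ : Fin m → EuclideanSpace ℂ (Fin d), (∀ j, ‖ψ j‖ = ‖φ j‖) ∧
      (∀ j, ‖ψ j - φ j‖ ≤ η) ∧ frameOperator ψ = S i := by
  filter_upwards [eventually_exists_mul_conjTranspose hS htr hr hlim (eventually_exists_list h hη)]
    with i ⟨R, hR, hRS⟩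
  rw [← hRS]
  exact hR (by rw [hRS, htr])

end FramePerturbation

theorem mainTheorem5 {m d : ℕ} (φ : Fin m → EuclideanSpace ℂ (Fin d)) :
    -- a list that does not split orthogonally has a local cross section
    (¬ FramePerturbation.OrthogonallySplits φ →
      FramePerturbation.HasLocalCrossSection (FramePerturbation.grammian φ)) ∧
    -- perturbation of a list whose Grammian admits a local cross section
    (FramePerturbation.HasLocalCrossSection (FramePerturbation.grammian φ) →
      ∀ S : ℕ → Matrix (Fin d) (Fin d) ℂ,
        (∀ i, (S i).PosSemidef) →
        (∀ i, (S i).trace = (FramePerturbation.frameOperator φ).trace) →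
        (∀ i, (S i).rank ≤ m) →
        Filter.Tendsto S Filter.atTop (nhds (FramePerturbation.frameOperator φ)) →
        ∀ η : ℝ, 0 < η → ∃ i₁ : ℕ, ∀ i ≥ i₁, ∃ ψ : Fin m → EuclideanSpace ℂ (Fin d),
          (∀ j, ‖ψ j‖ = ‖φ j‖) ∧ (∀ j, ‖ψ j - φ j‖ ≤ η) ∧
          FramePerturbation.frameOperator ψ = S i ∧
          ((S i).PosDef → FramePerturbation.IsFrame ψ)) ∧
    -- perturbation of a frame that does not split orthogonally
    (FramePerturbation.IsFrame φ → ¬ FramePerturbation.OrthogonallySplits φ →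
      ∀ S : ℕ → Matrix (Fin d) (Fin d) ℂ,
        (∀ i, (S i).PosSemidef) →
        (∀ i, (S i).trace = (FramePerturbation.frameOperator φ).trace) →
        Filter.Tendsto S Filter.atTop (nhds (FramePerturbation.frameOperator φ)) →
        ∀ η : ℝ, 0 < η → ∃ i₁ : ℕ, ∀ i ≥ i₁, ∃ ψ : Fin m → EuclideanSpace ℂ (Fin d),
          FramePerturbation.IsFrame ψ ∧
          (∀ j, ‖ψ j‖ = ‖φ j‖) ∧ (∀ j, ‖ψ j - φ j‖ ≤ η) ∧
          FramePerturbation.frameOperator ψ = S i) := by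
  open FramePerturbation in
  refine ⟨fun h => hasLocalCrossSection_of_isConnectedMatrix (isHermitian_grammian φ)
    (isConnectedMatrix_grammian h), fun h S hS htr hr hlim η hη => ?_,
    fun hF h S hS htr hlim η hη => ?_⟩
  -- The given section serves only to exclude a splitting.
  · obtain ⟨i₁, hi⟩ := Filter.eventually_atTop.mp
      (eventually_exists_perturbation (not_orthogonallySplits h) hS htr hr hlim hη)
    refine ⟨i₁, fun i hii => ?_⟩
    obtain ⟨ψ, h1, h2, h3⟩ := hi i hii
    exact ⟨ψ, h1, h2, h3, fun hpd => isFrame_of_posDef (h3 ▸ hpd)⟩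
  · have hr (i : ℕ) : (S i).rank ≤ m := (Matrix.rank_le_width (S i)).trans hF.le
    -- For positive semidefinite matrices, a nonzero determinant is positive definiteness, and it is
    -- an open condition.
    have hdet : ∀ᶠ i in Filter.atTop, (S i).det ≠ 0 :=
      ((Continuous.matrix_det continuous_id).continuousAt.tendsto.comp hlim).eventually_ne
        ((posSemidef_frameOperator φ).posDef_iff_det_ne_zero.mp hF.posDef_frameOperator)
    obtain ⟨i₁, hi⟩ := Filter.eventually_atTop.mp
      ((eventually_exists_perturbation h hS htr hr hlim hη).and hdet)
    refine ⟨i₁, fun i hii => ?_⟩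
    obtain ⟨⟨ψ, h1, h2, h3⟩, h4⟩ := hi i hii
    exact ⟨ψ, isFrame_of_posDef (h3 ▸ (hS i).posDef_iff_det_ne_zero.mpr h4), h1, h2, h3⟩
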